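/- Let $G$ be a finite simple graph on $n$ vertices, with independence number $\alpha$ and clique number $\omega$. A connected dominating set of $G$ is a set $D$ of vertices such that every vertex is in $D$ or adjacent to a vertex of $D$, and the induced subgraph $G[D]$ is connected and non-empty; $\gamma_c(G)$ is the least cardinality of such a set ($\infty$ if there is none, that is, if $G$ is not connected). Call $G$ maximal $3$-$\gamma_c$-vertex critical if $\gamma_c(G)=3$, $\gamma_c(G+uv)<3$ for every pair of distinct non-adjacent vertices $u,v$, and $\gamma_c(G-v)<3$ for every vertex $v$ (so $G$ is $2$-connected). For $l\ge 2$ let $\mathcal G_1(l)$ be the class of graphs isomorphic to the graph with the $2l+1$ vertices $v,z_1,\dots,z_l,q_1,\dots,q_l$ in which $v$ is adjacent to all $z_i$ and to no $q_i$, the $z_i$ are pairwise non-adjacent, the $q_i$ are pairwise adjacent, and $z_i$ is adjacent to $q_j$ if and only if $i\ne j$. **Theorem.** If $G$ is a maximal $3$-$\gamma_c$-vertex critical graph of order $n$, then $$\alpha+\omega\le n-1,$$ and equality holds if and only if $G\in\mathcal G_1(l)$ for some $l\ge 2$. -/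

import Mathlib

namespace ConnDom

/-- `D` is a connected dominating set of `G`: every vertex is in `D` or adjacent to a vertex of `D`,
and the induced subgraph `G[D]` is connected (in particular `D` is non-empty). -/
def IsConnectedDominating {V : Type*} (G : SimpleGraph V) (D : Set V) : Prop :=
  (∀ x, x ∈ D ∨ ∃ y ∈ D, G.Adj x y) ∧ (G.induce D).Connected

/-- The connected domination number `γ_c(G)`, the least cardinality of a connected dominating set.
It is `⊤` when there is no connected dominating set, that is, when `G` is not connected. -/
noncomputable def connDomNumber {V : Type*} (G : SimpleGraph V) : ℕ∞ :=
  ⨅ D ∈ {D : Set V | IsConnectedDominating G D}, D.encard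

/-- `G` is `k`-`γ_c`-edge critical: `γ_c(G) = k`, and `γ_c(G + uv) < k` for each pair of
non-adjacent vertices `u`, `v`. -/
def IsEdgeCritical {V : Type*} (k : ℕ) (G : SimpleGraph V) : Prop :=
  connDomNumber G = k ∧
    ∀ u v : V, u ≠ v → ¬ G.Adj u v → connDomNumber (G ⊔ SimpleGraph.edge u v) < k

/-- `G` is `k`-`γ_c`-vertex critical: `γ_c(G) = k`, and `γ_c(G - v) < k` for each vertex `v`.
As `γ_c` is `⊤` for a graph without connected dominating sets, `G` and every `G - v` are then
connected, so that there is no need to ask separately that `G` has no cut vertex. -/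
def IsVertexCritical {V : Type*} (k : ℕ) (G : SimpleGraph V) : Prop :=
  connDomNumber G = k ∧ ∀ v : V, connDomNumber (G.induce {u | u ≠ v}) < k

/-- `G` is maximal `k`-`γ_c`-vertex critical: both edge critical and vertex critical. -/
def IsMaximalVertexCritical {V : Type*} (k : ℕ) (G : SimpleGraph V) : Prop :=
  IsEdgeCritical k G ∧ IsVertexCritical k G

/-- The `2 l + 1` vertices `v`, `z_i`, `q_i` (`i < l`) of the graph in `𝒢₁(l)`. -/
inductive G1Vertex (l : ℕ) : Type
  | v : G1Vertex l
  | z (i : Fin l) : G1Vertex l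
  | q (i : Fin l) : G1Vertex l

/-- Adjacency in the graph of `𝒢₁(l)`: `v` is joined to every `z_i`; the `z_i` are pairwise
non-adjacent; the `q_i` form a complete graph; and `z_i` is joined to `q_j` exactly for `i ≠ j`. -/
def G1Adj {l : ℕ} : G1Vertex l → G1Vertex l → Prop
  | .v, .z _ => True
  | .z _, .v => True
  | .z i, .q j => i ≠ j
  | .q i, .z j => i ≠ j
  | .q i, .q j => i ≠ j
  | _, _ => False

/-- The graph `v ∨ K̄_l ∨ K_l - z_1 q_1 - ⋯ - z_l q_l`, where the joins are between consecutive
terms only (`v` is not joined to `K_l`). -/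
def G1Graph (l : ℕ) : SimpleGraph (G1Vertex l) where
  Adj := G1Adj
  symm := ⟨by
    intro a b h
    cases a <;> cases b <;> simp_all [G1Adj, eq_comm]⟩
  loopless := ⟨by
    intro a h
    cases a <;> simp_all [G1Adj]⟩

/-- `G ∈ 𝒢₁(l)`, for `l ≥ 2`: `G` is a copy of the graph `G1Graph l`. -/
def MemG1 {V : Type*} (l : ℕ) (G : SimpleGraph V) : Prop :=
  2 ≤ l ∧ Nonempty (G ≃g G1Graph l)

end ConnDom

namespace ConnDom

open SimpleGraph

variable {V : Type*} {G : SimpleGraph V}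

/-! Criticality is used only through three statements: no vertex or edge dominates `G`; for each
vertex some edge dominates exactly the other vertices; a non-edge is itself dominating or has an end
on an edge dominating all but possibly the other end. Take a maximum independent set `I` and a
maximum clique `K`; they share at most one vertex, so the size of `α + ω` says how few vertices lie
outside `I ∪ K`. For `v ∈ K`, the edge missing `v` has no end in `K` and at most one in `I`, so it
uses an outside vertex. With a single outside vertex `x`, it must join `x` to `I`. This rules out `α
+ ω ≥ n` and, when `I` and `K` are disjoint, forces the adjacencies of `𝒢₁(l)`
(`exists_memG1_of_cover_insert`). If `α + ω = n - 1` and `I`, `K` share `k`, two vertices `x`, `y`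
are outside. An exchange (`exchange_of_cover_insert_insert`) puts one of them in place of `k` in `I`
or `K`, which reduces to the disjoint case. Conversely, in `𝒢₁(l)` the `z_i` and the `q_i` give `α +
ω ≥ 2l = n - 1`. -/

/-- Every vertex other than `v` is one of `a`, `b` or a neighbour of one of them. -/
def PairCoversExcept (G : SimpleGraph V) (v a b : V) : Prop :=
  ∀ w, w ≠ v → w = a ∨ w = b ∨ G.Adj a w ∨ G.Adj b w

theorem PairCoversExcept.eq_or {v a b : V} (h : PairCoversExcept G v a b) (w : V) :
    w = v ∨ w = a ∨ w = b ∨ G.Adj a w ∨ G.Adj b w := by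
  have := h w
  tauto

theorem PairCoversExcept.symm {v a b : V} (h : PairCoversExcept G v a b) :
    PairCoversExcept G v b a := by
  intro w hw
  have := h w hw
  tauto

/-- No vertex and no edge dominates the whole graph. -/
def NoDominatingEdge (G : SimpleGraph V) : Prop :=
  ∀ a b, (a = b ∨ G.Adj a b) → ∃ w, w ≠ a ∧ w ≠ b ∧ ¬ G.Adj a w ∧ ¬ G.Adj b w

/-- For each vertex `v` some edge dominates exactly the vertices other than `v`. -/
def EdgeMissesEachVertex (G : SimpleGraph V) : Prop :=
  ∀ v, ∃ a b, G.Adj a b ∧ a ≠ v ∧ b ≠ v ∧ ¬ G.Adj v a ∧ ¬ G.Adj v b ∧ PairCoversExcept G v a b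

/-- For non-adjacent `u`, `v`, either `u`, `v` dominate together, or an edge at one of them
dominates everything but the other. -/
def EdgeMissesEachNonedge (G : SimpleGraph V) : Prop :=
  ∀ u v, u ≠ v → ¬ G.Adj u v →
    (∀ w, w = u ∨ w = v ∨ G.Adj u w ∨ G.Adj v w) ∨
    (∃ a, G.Adj u a ∧ PairCoversExcept G v u a) ∨
    (∃ a, G.Adj v a ∧ PairCoversExcept G u v a)

/-! ### From connected domination numbers to dominating edges. -/

theorem exists_isConnectedDominating_of_lt {k : ℕ∞} (h : connDomNumber G < k) :
    ∃ D, IsConnectedDominating G D ∧ D.encard < k := by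
  simp only [connDomNumber, iInf_lt_iff] at h
  obtain ⟨D, hD, hk⟩ := h
  exact ⟨D, hD, hk⟩

theorem connDomNumber_le_encard {D : Set V} (hD : IsConnectedDominating G D) :
    connDomNumber G ≤ D.encard :=
  iInf₂_le D hD

theorem exists_pair_of_connDomNumber_lt_three (h : connDomNumber G < 3) :
    ∃ a b, (a = b ∨ G.Adj a b) ∧ ∀ w, w = a ∨ w = b ∨ G.Adj a w ∨ G.Adj b w := by
  obtain ⟨D, ⟨hdom, hconn⟩, hcard⟩ := exists_isConnectedDominating_of_lt h
  obtain ⟨⟨a, ha⟩⟩ := hconn.nonempty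
  by_cases hsub : D ⊆ {a}
  · refine ⟨a, a, Or.inl rfl, fun w => ?_⟩
    rcases hdom w with hw | ⟨y, hy, hwy⟩
    · exact Or.inl (hsub hw)
    · rw [Set.mem_singleton_iff.1 (hsub hy)] at hwy
      exact Or.inr (Or.inr (Or.inl hwy.symm))
  · have : Nontrivial D := by
      obtain ⟨b, hb, hba⟩ := Set.not_subset.1 hsub
      exact ⟨⟨b, hb⟩, ⟨a, ha⟩, fun h => hba (by simpa using h)⟩
    obtain ⟨⟨b, hb⟩, hab⟩ := hconn.preconnected.exists_adj_of_nontrivial ⟨a, ha⟩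
    have hab' : G.Adj a b := hab
    have hD : ∀ w ∈ D, w = a ∨ w = b := by
      intro w hw
      by_contra! hne
      have h3 : ({w, a, b} : Set V).encard = 3 :=
        Set.encard_eq_three.2 ⟨w, a, b, hne.1, hne.2, hab'.ne, rfl⟩
      have : ({w, a, b} : Set V).encard ≤ D.encard := Set.encard_le_encard (by
        rintro u (rfl | rfl | rfl) <;> assumption)
      rw [h3] at this
      exact absurd hcard (not_lt.2 this)
    refine ⟨a, b, Or.inr hab', fun w => ?_⟩
    rcases hdom w with hw | ⟨y, hy, hwy⟩
    · rcases hD w hw with h | h <;> simp [h]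
    · rcases hD y hy with rfl | rfl <;> simp [hwy.symm]

theorem encard_pair_le_two (a b : V) : ({a, b} : Set V).encard ≤ 2 :=
  (Set.encard_insert_le _ _).trans (by rw [Set.encard_singleton]; exact le_of_eq one_add_one_eq_two)

theorem noDominatingEdge_of_connDomNumber (h : connDomNumber G = 3) : NoDominatingEdge G := by
  intro a b hab
  by_contra! hcov
  have hconn : (G.induce {a, b}).Connected := by
    rcases hab with rfl | hab
    · rw [Set.pair_eq_singleton]
      exact .of_subsingleton
    · exact SimpleGraph.induce_pair_connected_of_adj hab
  have hD : IsConnectedDominating G {a, b} := by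
    refine ⟨fun w => ?_, hconn⟩
    have := hcov w
    simp only [Set.mem_insert_iff, Set.mem_singleton_iff, exists_eq_or_imp, exists_eq_left]
    by_cases h1 : w = a
    · exact Or.inl (Or.inl h1)
    by_cases h2 : w = b
    · exact Or.inl (Or.inr h2)
    by_cases h3 : G.Adj a w
    · exact Or.inr (Or.inl h3.symm)
    · exact Or.inr (Or.inr (this h1 h2 h3).symm)
  have h2 := (connDomNumber_le_encard hD).trans (encard_pair_le_two a b)
  rw [h] at h2
  exact absurd h2 (by decide)

theorem exists_ne_ne_of_connDomNumber (h : connDomNumber G = 3) (a b : V) :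
    ∃ w, w ≠ a ∧ w ≠ b := by
  by_contra! hall
  obtain ⟨D, hD, -⟩ := exists_isConnectedDominating_of_lt (G := G) (k := 4) (by rw [h]; decide)
  have hsub : D ⊆ {a, b} := fun w _ => by
    by_cases hw : w = a
    · exact Or.inl hw
    · exact Or.inr (hall w hw)
  have h2 := (connDomNumber_le_encard hD).trans
    ((Set.encard_le_encard hsub).trans (encard_pair_le_two a b))
  rw [h] at h2
  exact absurd h2 (by decide)

theorem edgeMissesEachVertex_of_isVertexCritical (h : IsVertexCritical 3 G) :
    EdgeMissesEachVertex G := by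
  have hno := noDominatingEdge_of_connDomNumber h.1
  have key : ∀ v, ∃ a b, (a = b ∨ G.Adj a b) ∧ a ≠ v ∧ b ≠ v ∧ ¬ G.Adj v a ∧ ¬ G.Adj v b ∧
      PairCoversExcept G v a b := by
    intro v
    obtain ⟨⟨a, ha⟩, ⟨b, hb⟩, hab, hcov⟩ := exists_pair_of_connDomNumber_lt_three (h.2 v)
    have hab' : a = b ∨ G.Adj a b := by simpa using hab
    have hcov' : PairCoversExcept G v a b := fun w hw => by simpa using hcov ⟨w, hw⟩
    obtain ⟨w, hw⟩ := hno a b hab'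
    have hwv : w = v := by
      by_contra hne
      have := hcov' w hne
      tauto
    subst hwv
    exact ⟨a, b, hab', ha, hb, fun h => hw.2.2.1 h.symm, fun h => hw.2.2.2 h.symm, hcov'⟩
  intro v
  obtain ⟨a, b, hab, hav, hbv, hva, hvb, hcov⟩ := key v
  rcases hab with rfl | hab
  -- If `a` alone dominates all but `v`, the edge missing `a` can only have ends equal to `v`, so
  -- `v` dominates all but `a`. A third vertex is then adjacent to both, and its edge to `a`
  -- dominates `G`.
  · exfalso
    obtain ⟨c, d, -, hca, hda, hac, had, hcov'⟩ := key a
    obtain rfl : c = v := by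
      by_contra hne
      have := hcov c hne
      tauto
    obtain rfl : d = c := by
      by_contra hne
      have := hcov d hne
      tauto
    obtain ⟨w, hwa, hwd⟩ := exists_ne_ne_of_connDomNumber h.1 a d
    have h1 : G.Adj a w := by have := hcov w hwd; tauto
    have h2 : G.Adj d w := by have := hcov' w hwa; tauto
    obtain ⟨u, hua, huw, hau, hwu⟩ := hno a w (Or.inr h1)
    have hud : u ≠ d := by rintro rfl; exact hwu h2.symm
    have := hcov u hud
    tauto
  · exact ⟨a, b, hab, hav, hbv, hva, hvb, hcov⟩

theorem edgeMissesEachNonedge_of_isEdgeCritical (h : IsEdgeCritical 3 G)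
    (hvc : EdgeMissesEachVertex G) : EdgeMissesEachNonedge G := by
  have hno := noDominatingEdge_of_connDomNumber h.1
  intro u v huv hadj
  obtain ⟨a, b, hab, hcov⟩ := exists_pair_of_connDomNumber_lt_three (h.2 u v huv hadj)
  simp only [SimpleGraph.sup_adj, SimpleGraph.edge_adj] at hab hcov
  have hsingle : ∀ c d, c ≠ d → ¬ PairCoversExcept G d c c := by
    intro c d hcd hc
    obtain ⟨p, q, hpq, hp, hq, hcp, hcq, -⟩ := hvc c
    have h1 : p = d := by
      by_contra hne
      have := hc p hne
      tauto
    have h2 : q = d := by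
      by_contra hne
      have := hc q hne
      tauto
    exact hpq.ne (h1.trans h2.symm)
  have h1 := hsingle u v huv
  have h2 := hsingle v u huv.symm
  -- A pair that is already equal or adjacent in `G` leaves some `w` undominated there, so it needs
  -- the new edge: `w` is one of `u`, `v` and the other is in the pair. Otherwise the pair is `u`,
  -- `v` itself.
  by_cases hG : a = b ∨ G.Adj a b
  · obtain ⟨w, hw⟩ := hno a b hG
    have hw' := hcov w
    have hsymm := fun x y => G.adj_comm x y
    unfold PairCoversExcept at *
    grind
  · left
    have : (u = a ∧ v = b) ∨ (u = b ∧ v = a) := by tauto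
    rcases this with ⟨rfl, rfl⟩ | ⟨rfl, rfl⟩ <;> intro w <;> have := hcov w <;> tauto

/-! ### An independent set and a clique missing at most one vertex. -/

section OneOutside

variable {I K : Set V} {x : V}

theorem exists_pair_of_cover_insert (hvc : EdgeMissesEachVertex G) (hI : G.IsIndepSet I)
    (hK : G.IsClique K) (hcov : ∀ w, w ∈ I ∨ w ∈ K ∨ w = x) {v : V} (hv : v ∈ K) :
    v ≠ x ∧ ¬ G.Adj v x ∧ ∃ i ∈ I, i ≠ v ∧ ¬ G.Adj v i ∧ G.Adj x i ∧ PairCoversExcept G v x i := by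
  obtain ⟨a, b, hab, hav, hbv, hva, hvb, hc⟩ := hvc v
  have hKn : ∀ w, w ≠ v → ¬ G.Adj v w → w ∉ K := fun w hne hadj hw => hadj (hK hv hw hne.symm)
  have ha := hcov a
  have hb := hcov b
  have hIab : ¬ (a ∈ I ∧ b ∈ I) := fun h => hI h.1 h.2 hab.ne hab
  have haK := hKn a hav hva
  have hbK := hKn b hbv hvb
  by_cases hax : a = x
  · subst hax
    have : b ∈ I := by rcases hb with h | h | h <;> [exact h; tauto; exact absurd h.symm hab.ne]
    exact ⟨hav.symm, hva, b, this, hbv, hvb, hab, hc⟩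
  · have hbx : b = x := by tauto
    subst hbx
    refine ⟨hbv.symm, hvb, a, by tauto, hav, hva, hab.symm, fun w hw => ?_⟩
    have := hc w hw
    tauto

/-- The edge `xi` missing `k` dominates the rest of `K`, and `x` has no neighbour there, so `i` can
replace `k` in the clique. Applied to the new clique, the previous lemma says that `x` and `i` are
not adjacent. -/
theorem not_exists_mem_inter_of_cover_insert (hvc : EdgeMissesEachVertex G)
    (hI : G.IsIndepSet I) (hK : G.IsClique K) (hcov : ∀ w, w ∈ I ∨ w ∈ K ∨ w = x) {k : V}
    (hkI : k ∈ I) (hkK : k ∈ K) : False := by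
  obtain ⟨-, -, i, hi, hik, hki, hxi, hc⟩ := exists_pair_of_cover_insert hvc hI hK hcov hkK
  have hKi : ∀ w ∈ K, w ≠ k → w ≠ i → G.Adj i w := fun w hw hwk hwi => by
    have := exists_pair_of_cover_insert hvc hI hK hcov hw
    have h2 := hc w hwk
    have := this.2.1
    rw [G.adj_comm] at this
    tauto
  have hK' : G.IsClique (insert i (K \ {k})) := by
    rw [SimpleGraph.isClique_insert]
    exact ⟨hK.subset Set.sdiff_subset, fun w hw hne => hKi w hw.1 hw.2 hne.symm⟩
  have := exists_pair_of_cover_insert (x := x) hvc hI hK' (fun w => by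
    have := hcov w
    by_cases hwk : w = k
    · exact Or.inl (hwk ▸ hkI)
    · simp only [Set.mem_insert_iff, Set.mem_sdiff, Set.mem_singleton_iff]
      tauto) (Set.mem_insert i _)
  exact this.2.1 hxi.symm

theorem not_cover_of_nonempty_clique (hvc : EdgeMissesEachVertex G)
    (hI : G.IsIndepSet I) (hK : G.IsClique K) (hne : K.Nonempty)
    (hcov : ∀ w, w ∈ I ∨ w ∈ K) : False := by
  obtain ⟨v, hv⟩ := hne
  -- Choosing a vertex of `K` itself as the outside vertex contradicts `v ≠ x`.
  exact (exists_pair_of_cover_insert (x := v) hvc hI hK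
    (fun w => (hcov w).imp_right Or.inl) hv).1 rfl

theorem exists_memG1_of_cover_insert [Finite V] (hvc : EdgeMissesEachVertex G)
    (hI : G.IsIndepSet I) (hK : G.IsClique K) (hne : K.Nonempty)
    (hcov : ∀ w, w ∈ I ∨ w ∈ K ∨ w = x) (hxI : x ∉ I) (hIK : Disjoint I K) :
    ∃ l, MemG1 l G := by
  have hpair := fun v : K => exists_pair_of_cover_insert hvc hI hK hcov v.2
  have hdisj : ∀ w, w ∈ I → w ∉ K := fun w h1 h2 => Set.disjoint_left.1 hIK h1 h2
  have hxK : ∀ v ∈ K, ¬ G.Adj v x := fun v hv => (hpair ⟨v, hv⟩).2.1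
  have hxK' : x ∉ K := fun h => (hpair ⟨x, h⟩).1 rfl
  have hxadj : ∀ i ∈ I, G.Adj x i := by
    intro i hi
    obtain ⟨v, hv⟩ := hne
    obtain ⟨-, -, j, hj, hjv, hvj, hxj, hc⟩ := hpair ⟨v, hv⟩
    by_cases hij : i = j
    · exact hij ▸ hxj
    · have h1 := hc i (fun h => hdisj i hi (h ▸ hv))
      have h2 : ¬ G.Adj j i := hI hj hi (Ne.symm hij)
      have h3 : i ≠ x := fun h => hxI (h ▸ hi)
      tauto
  have hf : ∀ v : K, ∃ i : I, ∀ w : K, G.Adj i w ↔ w ≠ v := by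
    intro v
    obtain ⟨-, -, j, hj, hjv, hvj, hxj, hc⟩ := hpair v
    refine ⟨⟨j, hj⟩, fun w => ⟨?_, fun hwv => ?_⟩⟩
    · rintro h rfl
      exact hvj h.symm
    · have h1 := hc w (fun h => hwv (Subtype.ext h))
      have h2 : ¬ G.Adj x w := fun h => hxK w w.2 h.symm
      have h3 : (w : V) ≠ x := fun h => hxK' (h ▸ w.2)
      have h4 : (w : V) ≠ j := fun h => hdisj j hj (h ▸ w.2)
      tauto
  -- The edge missing `i` avoids `x`, which is adjacent to `i`, and must dominate `x`, which has no
  -- neighbour in `K`. So it joins `K` to `I`, and its end in `K` dominates the rest of `I`.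
  have hg : ∀ i : I, ∃ a : K, (∃ j : I, j ≠ i) ∧ ∀ j : I, G.Adj a j ↔ j ≠ i := by
    intro i
    have aux : ∀ a b, G.Adj a b → a ≠ i → b ≠ i → ¬ G.Adj i a → ¬ G.Adj i b →
        PairCoversExcept G i a b → a ∈ K → ∃ a : K, (∃ j : I, j ≠ i) ∧
          ∀ j : I, G.Adj a j ↔ j ≠ i := by
      intro a b hab ha hb hia hib hc haK
      have hxi : ∀ w, w = x → ¬ G.Adj i w → False := by
        rintro w rfl h
        exact h (hxadj i i.2).symm
      have hbK : b ∉ K := fun h => by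
        have h1 := hc x (fun h => hxI (h ▸ i.2))
        have h2 := hxK a haK
        have h3 := hxK b h
        have h4 : x ≠ a := fun h => hxK' (h ▸ haK)
        have h5 : x ≠ b := fun h' => hxK' (h' ▸ h)
        tauto
      have hbI : b ∈ I := by
        have := hcov b
        have := hxi b
        tauto
      refine ⟨⟨a, haK⟩, ⟨⟨b, hbI⟩, fun h => hb (congrArg Subtype.val h)⟩, fun j => ⟨?_, fun hj => ?_⟩⟩
      · rintro h rfl
        exact hia h.symm
      · by_cases hjb : (j : V) = b
        · simpa [hjb] using hab
        · have h1 := hc j (fun h => hj (Subtype.ext h))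
          have h2 : ¬ G.Adj b j := hI hbI j.2 (Ne.symm hjb)
          have h3 : (j : V) ≠ a := fun h => hdisj j j.2 (h ▸ haK)
          tauto
    obtain ⟨a, b, hab, ha, hb, hia, hib, hc⟩ := hvc i
    by_cases haK : a ∈ K
    · exact aux a b hab ha hb hia hib hc haK
    · have hxi := (hxadj i i.2).symm
      have haI : a ∈ I := by
        rcases hcov a with h | h | h
        · exact h
        · exact absurd h haK
        · exact absurd (h ▸ hxi) hia
      have hbK : b ∈ K := by
        rcases hcov b with h | h | h
        · exact absurd hab (hI haI h hab.ne)
        · exact h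
        · exact absurd (h ▸ hxi) hib
      refine aux b a hab.symm hb ha hib hia hc.symm hbK
  choose f hf using hf
  choose g hg0 hg using hg
  have hfinj : Function.Injective f := by
    intro v w hvw
    by_contra hne
    have h1 := (hf v w).2 (Ne.symm hne)
    rw [hvw] at h1
    exact (hf w w).1 h1 rfl
  have hfg : ∀ i, f (g i) = i := by
    intro i
    by_contra hne
    exact (hf (g i) (g i)).1 (((hg i (f (g i))).2 hne).symm) rfl
  obtain ⟨l, ⟨e⟩⟩ := Finite.exists_equiv_fin K
  refine ⟨l, ?_, ?_⟩
  · obtain ⟨v, hv⟩ := hne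
    obtain ⟨j, hj⟩ := hg0 (f ⟨v, hv⟩)
    have hne : e (g j) ≠ e ⟨v, hv⟩ := fun h => hj (by rw [← e.injective h, hfg])
    have h1 := (e (g j)).2
    have h2 := (e ⟨v, hv⟩).2
    have h3 : (e (g j) : ℕ) ≠ e ⟨v, hv⟩ := fun h => hne (Fin.ext h)
    omega
  · let φ : G1Vertex l → V
      | .v => x
      | .z i => f (e.symm i)
      | .q i => e.symm i
    have hφ : Function.Bijective φ := by
      constructor
      · have hzq : ∀ i j, ((f (e.symm i) : I) : V) ≠ (e.symm j : K) := fun i j h =>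
          hdisj _ (f (e.symm i)).2 (h ▸ (e.symm j).2)
        have hz : ∀ i, ((f (e.symm i) : I) : V) ≠ x := fun i h => hxI (h ▸ (f (e.symm i)).2)
        have hq : ∀ i, ((e.symm i : K) : V) ≠ x := fun i h => hxK' (h ▸ (e.symm i).2)
        rintro (_ | i | i) (_ | j | j) h
        · rfl
        · exact absurd h.symm (hz j)
        · exact absurd h.symm (hq j)
        · exact absurd h (hz i)
        · exact congrArg _ (e.symm.injective (hfinj (Subtype.ext h)))
        · exact absurd h (hzq i j)
        · exact absurd h (hq i)
        · exact absurd h.symm (hzq j i)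
        · exact congrArg _ (e.symm.injective (Subtype.ext h))
      · intro w
        rcases hcov w with h | h | h
        · exact ⟨.z (e (g ⟨w, h⟩)), by simp [φ, hfg]⟩
        · exact ⟨.q (e ⟨w, h⟩), by simp [φ]⟩
        · exact ⟨.v, h.symm⟩
    have hzq : ∀ i j, G.Adj (f (e.symm i) : I) (e.symm j : K) ↔ i ≠ j := fun i j => by
      rw [hf, Ne, e.symm.injective.eq_iff, eq_comm]
    refine ⟨RelIso.symm ⟨Equiv.ofBijective φ hφ, ?_⟩⟩
    rintro (_ | i | i) (_ | j | j)
    · exact iff_of_false (G.loopless.irrefl _) (fun h => h)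
    · exact iff_of_true (hxadj _ (f (e.symm j)).2) trivial
    · exact iff_of_false (fun h => hxK _ (e.symm j).2 h.symm) (fun h => h)
    · exact iff_of_true (hxadj _ (f (e.symm i)).2).symm trivial
    · refine iff_of_false (fun h => ?_) (fun h => h)
      exact hI (f (e.symm i)).2 (f (e.symm j)).2 h.ne h
    · exact hzq i j
    · exact iff_of_false (hxK _ (e.symm i).2) (fun h => h)
    · exact (G.adj_comm _ _).trans ((hzq j i).trans ne_comm)
    · change G.Adj (e.symm i : K) (e.symm j : K) ↔ i ≠ j
      refine ⟨?_, fun h => hK (e.symm i).2 (e.symm j).2 fun h' =>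
        h (e.symm.injective (Subtype.ext h'))⟩
      rintro h rfl
      exact G.loopless.irrefl _ h

end OneOutside

/-! ### Exchange when the two sets share a vertex and miss two. -/

section TwoOutside

variable {A B : Set V} {k x y : V}

/-- An independent set `A ∪ {k}` and a clique `B ∪ {k}` sharing `k`, which together miss `x` and
`y` only: if `k` is adjacent to `y`, then `y` can replace `k` in the independent set or `x` can
replace `k` in the clique. -/
theorem exchange_of_cover_insert_insert (hno : NoDominatingEdge G) (hvc : EdgeMissesEachVertex G)
    (hec : EdgeMissesEachNonedge G) (hI : G.IsIndepSet (insert k A))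
    (hK : G.IsClique (insert k B)) (hkA : k ∉ A) (hkB : k ∉ B)
    (hxA' : x ∉ A) (hxB' : x ∉ B) (hyA : y ∉ A) (hyB : y ∉ B)
    (hcov : ∀ w, w = k ∨ w ∈ A ∨ w ∈ B ∨ w = x ∨ w = y)
    (hAB : Disjoint A B) (hky : G.Adj k y)
    (htri : ∀ b, B = {b} → ∀ p q r, G.Adj p q → G.Adj q r → G.Adj p r → False) :
    (∀ a ∈ A, ¬ G.Adj y a) ∨ (∀ b ∈ B, G.Adj x b) := by
  by_contra! hcon
  obtain ⟨⟨i₀, hi₀, hyi₀⟩, b₀, hb₀, hxb₀⟩ := hcon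
  have hsymm := fun a b (h : G.Adj a b) => h.symm
  have hirr := fun a => G.loopless.irrefl a
  have hAA : ∀ a ∈ A, ∀ b ∈ A, ¬ G.Adj a b := fun a ha b hb h =>
    hI (Or.inr ha) (Or.inr hb) h.ne h
  have hkA' : ∀ a ∈ A, ¬ G.Adj k a := fun a ha h => hI (Or.inl rfl) (Or.inr ha) h.ne h
  have hBB : ∀ a ∈ B, ∀ b ∈ B, a ≠ b → G.Adj a b := fun a ha b hb h =>
    hK (Or.inr ha) (Or.inr hb) h
  have hkB' : ∀ b ∈ B, G.Adj k b := fun b hb =>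
    hK (Or.inl rfl) (Or.inr hb) (fun h => hkB (h ▸ hb))
  have hAB' : ∀ a ∈ A, a ∉ B := fun a h1 h2 => Set.disjoint_left.1 hAB h1 h2
  clear hI hK hAB
  obtain ⟨i, hi, hxk, hxi, hck⟩ : ∃ i ∈ A, ¬ G.Adj k x ∧ G.Adj x i ∧ PairCoversExcept G k x i := by
    obtain ⟨a, b, hab, ha, hb, hka, hkb, hc⟩ := hvc k
    have h1 := hcov a
    have h2 := hcov b
    have h3 := hc.symm
    grind
  have hxA : ∀ a ∈ A, G.Adj x a := by
    intro a ha
    have := hck.eq_or a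
    have := hcov x
    grind
  -- The edge missing `v` has no end in `B ∪ {k}` but dominates `k`, whose only neighbour elsewhere
  -- is `y`.
  have hpair : ∀ v ∈ B, ¬ G.Adj y v ∧ ∃ a, (a ∈ A ∨ a = x) ∧ G.Adj y a ∧ ¬ G.Adj v a ∧
      PairCoversExcept G v y a := by
    intro v hv
    obtain ⟨a, b, hab, ha, hb, hva, hvb, hc⟩ := hvc v
    have h1 := hcov a
    have h2 := hcov b
    have h3 := hc.eq_or k
    have h4 := hc.symm
    grind
  have hyB' : ∀ v ∈ B, ¬ G.Adj y v := fun v hv => (hpair v hv).1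
  obtain ⟨-, a, ha, hya, hb₀a, hca⟩ := hpair b₀ hb₀
  by_cases hxy : G.Adj x y
  · have hxB : ∀ b ∈ B, ¬ G.Adj x b := by
      intro b hb hxb
      obtain ⟨w, hw⟩ := hno x b (Or.inr hxb)
      have := hcov w
      grind
    have hiB : ∀ b ∈ B, G.Adj i b := by
      intro b hb
      have := hck.eq_or b
      grind
    -- Otherwise the edge missing `i` would have both ends in the independent set `A ∪ {k}`.
    have hyi : ¬ G.Adj y i := by
      obtain ⟨p, q, hpq, hp, hq, hip, hiq, -⟩ := hvc i
      have h1 := hcov p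
      have h2 := hcov q
      grind
    have hax : a = x := by
      rcases ha with ha | ha
      · have := hca.eq_or i
        grind
      · exact ha
    -- The edge `yx` misses only `b₀`, yet neither end has a neighbour in `B`.
    have hB : B = {b₀} := by
      ext b
      have := hca.eq_or b
      simp only [Set.mem_singleton_iff]
      grind
    exact htri b₀ hB x y i₀ hxy hyi₀ (hxA i₀ hi₀)
  · have haA : a ∈ A := by
      rcases ha with h | h
      · exact h
      · exact absurd (h ▸ hya).symm hxy
    have hxb : x ≠ b₀ := fun h => hxB' (h ▸ hb₀)
    -- In each case some vertex stays undominated. For an edge `b₀c`, dominating `y` but not `x`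
    -- forces `c = k`, which leaves `a` undominated.
    rcases hec x b₀ hxb hxb₀ with h | ⟨c, hxc, hc⟩ | ⟨c, hxc, hc⟩
    · have h1 := h y
      grind
    · have h1 := hc.eq_or k
      have h2 := hc.eq_or y
      have h3 := hcov c
      grind
    · obtain ⟨w, hw⟩ := hno b₀ c (Or.inr hxc)
      have h0 := hc.eq_or w
      have h1 := hc.eq_or a
      have h2 := hc.eq_or y
      have h3 := hcov c
      grind

theorem exists_memG1_of_cover_insert_insert [Finite V] (hno : NoDominatingEdge G)
    (hvc : EdgeMissesEachVertex G) (hec : EdgeMissesEachNonedge G)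
    (hI : G.IsIndepSet (insert k A)) (hK : G.IsClique (insert k B)) (hkA : k ∉ A) (hkB : k ∉ B)
    (hxA : x ∉ A) (hxB : x ∉ B) (hyA : y ∉ A) (hyB : y ∉ B) (hxk : x ≠ k) (hxy : x ≠ y)
    (hcov : ∀ w, w = k ∨ w ∈ A ∨ w ∈ B ∨ w = x ∨ w = y)
    (hAB : Disjoint A B) (hky : G.Adj k y)
    (htri : ∀ b, B = {b} → ∀ p q r, G.Adj p q → G.Adj q r → G.Adj p r → False) :
    ∃ l, MemG1 l G := by
  have hdisj : ∀ w, w ∈ A → w ∉ B := fun w h1 h2 => Set.disjoint_left.1 hAB h1 h2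
  rcases exchange_of_cover_insert_insert hno hvc hec hI hK hkA hkB hxA hxB hyA hyB hcov hAB hky
    htri with h | h
  · refine exists_memG1_of_cover_insert (x := x) (I := insert y A) hvc ?_ hK ⟨k, Or.inl rfl⟩
      (fun w => ?_) ?_ ?_
    · exact (hI.mono (Set.subset_insert _ _)).insert
        (fun b hb _ => ⟨h b hb, fun h' => h b hb h'.symm⟩)
    · have := hcov w
      simp only [Set.mem_insert_iff]
      tauto
    · simp only [Set.mem_insert_iff]
      tauto
    · rw [Set.disjoint_left]
      rintro w (rfl | hw) (rfl | hw')
      · exact hky.ne rfl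
      · exact hyB hw'
      · exact hkA hw
      · exact hdisj w hw hw'
  · refine exists_memG1_of_cover_insert (x := y) (K := insert x B) hvc hI ?_ ⟨x, Or.inl rfl⟩
      (fun w => ?_) ?_ ?_
    · rw [SimpleGraph.isClique_insert]
      exact ⟨hK.subset (Set.subset_insert _ _), fun b hb _ => h b hb⟩
    · have := hcov w
      simp only [Set.mem_insert_iff]
      tauto
    · rintro (h | h)
      · exact hky.ne h.symm
      · exact hyA h
    · rw [Set.disjoint_left]
      rintro w (rfl | hw) (rfl | hw')
      · exact hxk rfl
      · exact hkB hw'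
      · exact hxA hw
      · exact hdisj w hw hw'

end TwoOutside

/-! ### Counting, and the graphs attaining equality. -/

section Finset

theorem card_inter_le_one {I K : Finset V} [DecidableEq V] (hI : G.IsIndepSet I)
    (hK : G.IsClique K) : (I ∩ K).card ≤ 1 := by
  rw [Finset.card_le_one]
  intro a ha b hb
  rw [Finset.mem_inter] at ha hb
  by_contra hne
  exact hI ha.1 hb.1 hne (hK ha.2 hb.2 hne)

variable [Fintype V]

theorem two_le_cliqueNum_of_adj {a b : V} (h : G.Adj a b) : 2 ≤ G.cliqueNum := by
  classical
  have hc : G.IsClique (({a, b} : Finset V) : Set V) := by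
    simpa [SimpleGraph.isClique_pair] using fun _ => h
  simpa [Finset.card_pair h.ne] using hc.card_le_cliqueNum

theorem three_le_cliqueNum_of_adj {a b c : V} (hab : G.Adj a b) (hbc : G.Adj b c)
    (hac : G.Adj a c) : 3 ≤ G.cliqueNum := by
  classical
  have h := SimpleGraph.is3Clique_triple_iff.2 ⟨hab, hac, hbc⟩
  exact h.card_eq ▸ h.isClique.card_le_cliqueNum

theorem indepNum_add_cliqueNum_lt_card [Nonempty V] (hvc : EdgeMissesEachVertex G) :
    G.indepNum + G.cliqueNum < Fintype.card V := by
  classical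
  by_contra! hcard
  obtain ⟨I, hI, hIc⟩ := G.exists_isNIndepSet_indepNum
  obtain ⟨K, hK, hKc⟩ := G.exists_isNClique_cliqueNum
  have h1 := Finset.card_union_add_card_inter I K
  have h2 := card_inter_le_one hI hK
  have h3 := Finset.card_compl_add_card (I ∪ K)
  obtain ⟨a, b, hab, -⟩ := hvc (Classical.arbitrary V)
  have h4 := two_le_cliqueNum_of_adj hab
  have hmem : ∀ w, w ∉ (I ∪ K)ᶜ → w ∈ I ∨ w ∈ K := fun w hw => by
    rwa [Finset.mem_compl, not_not, Finset.mem_union] at hw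
  rcases (I ∩ K).eq_empty_or_nonempty with h | ⟨k, hk⟩
  · rw [h, Finset.card_empty] at h1
    have h5 : (I ∪ K)ᶜ = ∅ := Finset.card_eq_zero.1 (by omega)
    have hKne : K.Nonempty := Finset.card_pos.1 (by omega)
    exact not_cover_of_nonempty_clique hvc hI hK hKne.to_set
      (fun w => hmem w (by rw [h5]; exact Finset.notMem_empty w))
  · obtain ⟨x, hx⟩ := Finset.card_le_one_iff_subset_singleton.1
      (show (I ∪ K)ᶜ.card ≤ 1 by omega)
    rw [Finset.mem_inter] at hk
    refine not_exists_mem_inter_of_cover_insert (x := x) hvc hI hK (fun w => ?_) hk.1 hk.2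
    by_cases hw : w ∈ (I ∪ K)ᶜ
    · exact Or.inr (Or.inr (Finset.mem_singleton.1 (hx hw)))
    · exact (hmem w hw).imp_right Or.inl

theorem exists_memG1_of_indepNum_add_cliqueNum [Nonempty V] (hno : NoDominatingEdge G)
    (hvc : EdgeMissesEachVertex G) (hec : EdgeMissesEachNonedge G)
    (hcard : G.indepNum + G.cliqueNum + 1 = Fintype.card V) : ∃ l, MemG1 l G := by
  classical
  obtain ⟨I, hI, hIc⟩ := G.exists_isNIndepSet_indepNum
  obtain ⟨K, hK, hKc⟩ := G.exists_isNClique_cliqueNum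
  have h1 := Finset.card_union_add_card_inter I K
  have h2 := card_inter_le_one hI hK
  have h3 := Finset.card_compl_add_card (I ∪ K)
  obtain ⟨a, b, hab, -⟩ := hvc (Classical.arbitrary V)
  have h4 := two_le_cliqueNum_of_adj hab
  have hmem : ∀ w, w ∈ I ∨ w ∈ K ∨ w ∈ (I ∪ K)ᶜ := fun w => by
    rw [Finset.mem_compl, Finset.mem_union]
    tauto
  rcases (I ∩ K).eq_empty_or_nonempty with h | ⟨k, hk⟩
  · rw [h, Finset.card_empty] at h1
    obtain ⟨x, hx⟩ := Finset.card_eq_one.1 (show (I ∪ K)ᶜ.card = 1 by omega)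
    have hKne : K.Nonempty := Finset.card_pos.1 (by omega)
    have hxI : x ∈ (I ∪ K)ᶜ := by rw [hx]; exact Finset.mem_singleton_self x
    rw [Finset.mem_compl, Finset.mem_union, not_or] at hxI
    refine exists_memG1_of_cover_insert (x := x) hvc hI hK hKne.to_set (fun w => ?_) hxI.1 ?_
    · have := hmem w
      rwa [hx, Finset.mem_singleton] at this
    · exact Finset.disjoint_coe.2 (Finset.disjoint_iff_inter_eq_empty.2 h)
  · have hpos := Finset.card_pos.2 ⟨k, hk⟩
    obtain ⟨x, y, hxy, hxy'⟩ := Finset.card_eq_two.1 (show (I ∪ K)ᶜ.card = 2 by omega)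
    have hx : x ∈ (I ∪ K)ᶜ := by simp [hxy']
    have hy : y ∈ (I ∪ K)ᶜ := by simp [hxy']
    rw [Finset.mem_compl, Finset.mem_union, not_or] at hx hy
    rw [Finset.mem_inter] at hk
    have hinter : ∀ w ∈ I, w ∈ K → w = k := fun w h1 h2 => by
      by_contra hne
      exact hI h1 hk.1 hne (hK h2 hk.2 hne)
    have hcov : ∀ w, w = k ∨ w ∈ (I : Set V) \ {k} ∨ w ∈ (K : Set V) \ {k} ∨ w = x ∨ w = y := by
      intro w
      have := hmem w
      simp only [hxy', Finset.mem_insert, Finset.mem_singleton] at this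
      simp only [Set.mem_sdiff, Finset.mem_coe, Set.mem_singleton_iff]
      tauto
    have hI' : G.IsIndepSet (insert k ((I : Set V) \ {k})) := by
      rwa [Set.insert_sdiff_singleton, Set.insert_eq_of_mem (Finset.mem_coe.2 hk.1)]
    have hK' : G.IsClique (insert k ((K : Set V) \ {k})) := by
      rwa [Set.insert_sdiff_singleton, Set.insert_eq_of_mem (Finset.mem_coe.2 hk.2)]
    have hdisj : Disjoint ((I : Set V) \ {k}) ((K : Set V) \ {k}) := by
      rw [Set.disjoint_left]
      exact fun w h1 h2 => h1.2 (hinter w h1.1 h2.1)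
    -- The one use of the maximality of `K`: if `|K| = 2`, there is no triangle.
    have htri : ∀ b, (K : Set V) \ {k} = {b} → ∀ p q r, G.Adj p q → G.Adj q r → G.Adj p r →
        False := by
      intro b hb p q r hpq hqr hpr
      have h5 := three_le_cliqueNum_of_adj hpq hqr hpr
      have h6 : K ⊆ {k, b} := by
        intro w hw
        rw [Finset.mem_insert, Finset.mem_singleton]
        by_cases hwk : w = k
        · exact Or.inl hwk
        · exact Or.inr (hb.subset ⟨hw, hwk⟩)
      have h7 := (Finset.card_le_card h6).trans Finset.card_le_two
      omega
    -- The edge missing another vertex `v` of `K` has an end adjacent to `k`; that end is in neither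
    -- `K` nor `I`.
    have hadj : G.Adj k x ∨ G.Adj k y := by
      obtain ⟨v, hv, hvk⟩ := Finset.exists_mem_ne (show 1 < K.card by omega) k
      obtain ⟨a, b, hab, ha, hb, hva, hvb, hc⟩ := hvc v
      have aux : ∀ w, w ≠ v → ¬ G.Adj v w → k = w ∨ G.Adj w k → w = x ∨ w = y := by
        intro w hwv hvw hwk
        have hwK : w ∉ K := fun h => hvw (hK hv h hwv.symm)
        have hwk' : G.Adj w k := hwk.resolve_left fun h => hwK (h ▸ hk.2)
        have hwI : w ∉ I := fun h => hI h hk.1 hwk'.ne hwk'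
        have := hcov w
        have hne := hwk'.ne
        simp only [Set.mem_sdiff, Finset.mem_coe] at this
        tauto
      have key : ∀ w, w ≠ v → ¬ G.Adj v w → k = w ∨ G.Adj w k → G.Adj k x ∨ G.Adj k y := by
        intro w hwv hvw hwk
        have hwk' : G.Adj w k := hwk.resolve_left fun h => hvw (h ▸ hK hv hk.2 hvk)
        rcases aux w hwv hvw hwk with rfl | rfl
        · exact Or.inl hwk'.symm
        · exact Or.inr hwk'.symm
      rcases hc k hvk.symm with h | h | h | h
      · exact key a ha hva (Or.inl h)
      · exact key b hb hvb (Or.inl h)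
      · exact key a ha hva (Or.inr h)
      · exact key b hb hvb (Or.inr h)
    have hxk : x ≠ k := fun h => hx.1 (h ▸ hk.1)
    have hyk : y ≠ k := fun h => hy.1 (h ▸ hk.1)
    rcases hadj with h | h
    · refine exists_memG1_of_cover_insert_insert hno hvc hec hI' hK' (fun h => h.2 rfl)
        (fun h => h.2 rfl) (fun h => hy.1 h.1) (fun h => hy.2 h.1) (fun h => hx.1 h.1)
        (fun h => hx.2 h.1) hyk hxy.symm (fun w => ?_) hdisj h htri
      have := hcov w
      tauto
    · exact exists_memG1_of_cover_insert_insert hno hvc hec hI' hK' (fun h => h.2 rfl)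
        (fun h => h.2 rfl) (fun h => hx.1 h.1) (fun h => hx.2 h.1) (fun h => hy.1 h.1)
        (fun h => hy.2 h.1) hxk hxy hcov hdisj h htri

theorem G1Vertex.z_injective (l : ℕ) : Function.Injective (G1Vertex.z (l := l)) :=
  fun _ _ h => G1Vertex.z.inj h

theorem G1Vertex.q_injective (l : ℕ) : Function.Injective (G1Vertex.q (l := l)) :=
  fun _ _ h => G1Vertex.q.inj h

theorem card_of_memG1 {l : ℕ} (h : MemG1 l G) : Fintype.card V = 2 * l + 1 := by
  obtain ⟨-, ⟨e⟩⟩ := h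
  let ψ : Option (Fin l ⊕ Fin l) ≃ G1Vertex l :=
    { toFun := fun
        | none => .v
        | some (.inl i) => .z i
        | some (.inr i) => .q i
      invFun := fun
        | .v => none
        | .z i => some (.inl i)
        | .q i => some (.inr i)
      left_inv := by rintro (_ | _ | _) <;> rfl
      right_inv := by rintro (_ | _ | _) <;> rfl }
  rw [Fintype.card_congr (e.toEquiv.trans ψ.symm)]
  simp
  omega

theorem le_indepNum_of_memG1 {l : ℕ} (h : MemG1 l G) : l ≤ G.indepNum := by
  obtain ⟨-, ⟨e⟩⟩ := h
  let f : Fin l ↪ V := ⟨fun i => e.symm (.z i), e.symm.injective.comp (G1Vertex.z_injective l)⟩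
  have hI : G.IsIndepSet (Finset.univ.map f : Finset V) := by
    intro a ha b hb _
    simp only [Finset.coe_map, Finset.coe_univ, Set.image_univ, Set.mem_range] at ha hb
    obtain ⟨i, rfl⟩ := ha
    obtain ⟨j, rfl⟩ := hb
    exact fun h => (e.symm.map_adj_iff.1 h : False)
  simpa using hI.card_le_indepNum

theorem le_cliqueNum_of_memG1 {l : ℕ} (h : MemG1 l G) : l ≤ G.cliqueNum := by
  obtain ⟨-, ⟨e⟩⟩ := h
  let f : Fin l ↪ V := ⟨fun i => e.symm (.q i), e.symm.injective.comp (G1Vertex.q_injective l)⟩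
  have hK : G.IsClique (Finset.univ.map f : Finset V) := by
    intro a ha b hb hab
    simp only [Finset.coe_map, Finset.coe_univ, Set.image_univ, Set.mem_range] at ha hb
    obtain ⟨i, rfl⟩ := ha
    obtain ⟨j, rfl⟩ := hb
    exact e.symm.map_adj_iff.2 (show i ≠ j from fun h => hab (congrArg f h))
  simpa using hK.card_le_cliqueNum

end Finset

end ConnDom

theorem theorem3p6 {V : Type*} [Fintype V] (G : SimpleGraph V)
    (hG : ConnDom.IsMaximalVertexCritical 3 G) :
    G.indepNum + G.cliqueNum ≤ Fintype.card V - 1 ∧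
      (G.indepNum + G.cliqueNum = Fintype.card V - 1 ↔ ∃ l : ℕ, ConnDom.MemG1 l G) := by
  have hno := ConnDom.noDominatingEdge_of_connDomNumber hG.2.1
  have hvc := ConnDom.edgeMissesEachVertex_of_isVertexCritical hG.2
  have hec := ConnDom.edgeMissesEachNonedge_of_isEdgeCritical hG.1 hvc
  have : Nonempty V := by
    obtain ⟨D, hD, -⟩ := ConnDom.exists_isConnectedDominating_of_lt (G := G) (k := 4)
      (by rw [hG.2.1]; decide)
    exact hD.2.nonempty.map Subtype.val
  have hlt := ConnDom.indepNum_add_cliqueNum_lt_card hvc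
  refine ⟨by omega, fun h => ?_, ?_⟩
  · exact ConnDom.exists_memG1_of_indepNum_add_cliqueNum hno hvc hec (by omega)
  · rintro ⟨l, hl⟩
    have h1 := ConnDom.card_of_memG1 hl
    have h2 := ConnDom.le_indepNum_of_memG1 hl
    have h3 := ConnDom.le_cliqueNum_of_memG1 hl
    omega
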